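/- **Theorem 8.2.** A Lie algebra $L$ over a field $\mathbb F$ is called *zero product determined* (zpd) if for every bilinear map $f:L\times L\to\mathbb F$ such that $[x,y]=0$ implies $f(x,y)=0$ for all $x,y\in L$, there exists a linear map $\Phi:[L,L]\to\mathbb F$ with $f(x,y)=\Phi([x,y])$ for all $x,y\in L$. Let $\mathfrak g$ be a finite-dimensional simple Lie algebra over $\mathbb C$ with Killing form $(\cdot,\cdot)$, and let $$\tilde{\mathfrak g}=\mathfrak g\otimes\mathbb C[t,t^{-1}]\oplus\mathbb Cc\oplus\mathbb Cd$$ be the untwisted affine Lie algebra associated with $\mathfrak g$, in which $c$ is central and, for $x,y\in\mathfrak g$ and $m,n\in\mathbb Z$, $$[x\otimes t^n,\,y\otimes t^m]=[x,y]\otimes t^{n+m}+n\,(x,y)\,\delta_{n+m,0}\,c,\qquad [d,\,x\otimes t^n]=n\,x\otimes t^n .$$ Let $\hat{\mathfrak g}=[\tilde{\mathfrak g},\tilde{\mathfrak g}]$ be its derived algebra. Then both $\tilde{\mathfrak g}$ and $\hat{\mathfrak g}$ are zpd. -/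

import Mathlib

open scoped TensorProduct

/-- A Lie algebra `L` over a field `F` is *zero product determined* (zpd) if for every bilinear map
`f : L × L → F` such that `⁅x, y⁆ = 0` implies `f x y = 0`, there is a linear map
`Φ : [L, L] → F` with `f x y = Φ ⁅x, y⁆` for all `x, y`. Here `[L, L]` is the derived ideal. -/
def IsZeroProductDetermined (F : Type*) [Field F] (L : Type*) [LieRing L] [LieAlgebra F L] : Prop :=
  ∀ f : L →ₗ[F] L →ₗ[F] F, (∀ x y : L, ⁅x, y⁆ = 0 → f x y = 0) →
    ∃ Φ : (⁅(⊤ : LieIdeal F L), (⊤ : LieIdeal F L)⁆ : LieIdeal F L) →ₗ[F] F,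
      ∀ x y : L, f x y =
        Φ ⟨⁅x, y⁆, LieSubmodule.lie_mem_lie (LieSubmodule.mem_top x) (LieSubmodule.mem_top y)⟩

noncomputable section

/-- The loop algebra `𝔤 ⊗ ℂ[t, t⁻¹]` of a complex Lie algebra `𝔤`. (Mathlib's loop algebra, which
has the Laurent polynomials as the left tensor factor.) -/
def Loop (𝔤 : Type*) [LieRing 𝔤] [LieAlgebra ℂ 𝔤] : Type _ := LieAlgebra.loopAlgebra ℂ ℤ 𝔤

namespace Loop

variable (𝔤 : Type*) [LieRing 𝔤] [LieAlgebra ℂ 𝔤]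

instance : LieRing (Loop 𝔤) := inferInstanceAs (LieRing (LieAlgebra.loopAlgebra ℂ ℤ 𝔤))

instance : LieAlgebra ℂ (Loop 𝔤) := inferInstanceAs (LieAlgebra ℂ (LieAlgebra.loopAlgebra ℂ ℤ 𝔤))

/-- The identity map from the tensor product to the loop algebra. -/
def ofTensor : AddMonoidAlgebra ℂ ℤ ⊗[ℂ] 𝔤 ≃ₗ[ℂ] Loop 𝔤 where
  toFun a := a
  invFun a := a
  map_add' _ _ := rfl
  map_smul' _ _ := rfl
  left_inv _ := rfl
  right_inv _ := rfl

/-- The degree operator `t d/dt` on the Laurent polynomials `ℂ[t, t⁻¹]`: `t ^ n ↦ n t ^ n`. -/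
def degreeOp : AddMonoidAlgebra ℂ ℤ →ₗ[ℂ] AddMonoidAlgebra ℂ ℤ :=
  (AddMonoidAlgebra.basis ℤ ℂ).constr ℂ fun n => AddMonoidAlgebra.single n (n : ℂ)

/-- The degree operator on the loop algebra: `x ⊗ t ^ n ↦ n x ⊗ t ^ n`. -/
def loopDegree : Loop 𝔤 →ₗ[ℂ] Loop 𝔤 :=
  (ofTensor 𝔤).toLinearMap ∘ₗ degreeOp.rTensor 𝔤 ∘ₗ (ofTensor 𝔤).symm.toLinearMap

/-- The cocycle on the loop algebra: `(x ⊗ t ^ n, y ⊗ t ^ m) ↦ n (x, y) δ_{n + m, 0}`, where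
`(x, y)` is the Killing form. -/
def loopCocycle : Loop 𝔤 →ₗ[ℂ] Loop 𝔤 →ₗ[ℂ] ℂ :=
  (LieAlgebra.LoopAlgebra.residuePairing ℂ ℤ 𝔤 (killingForm ℂ 𝔤)).flip.compl₁₂
    (ofTensor 𝔤).symm.toLinearMap (ofTensor 𝔤).symm.toLinearMap

variable {𝔤}

/-- The element `x(n) = x ⊗ t ^ n` of the loop algebra. -/
def monomial (n : ℤ) (x : 𝔤) : Loop 𝔤 := ofTensor 𝔤 (AddMonoidAlgebra.single n 1 ⊗ₜ[ℂ] x)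

lemma loopDegree_monomial (n : ℤ) (x : 𝔤) :
    loopDegree 𝔤 (monomial n x) = (n : ℂ) • monomial n x := by
  have h : degreeOp (AddMonoidAlgebra.single n (1 : ℂ)) =
      (n : ℂ) • AddMonoidAlgebra.single n (1 : ℂ) := by
    have := (AddMonoidAlgebra.basis ℤ ℂ).constr_basis ℂ
      (fun n : ℤ => (AddMonoidAlgebra.single n (n : ℂ))) n
    rw [AddMonoidAlgebra.basis_apply] at this
    rw [degreeOp, this, AddMonoidAlgebra.smul_single, smul_eq_mul, mul_one]
  simp only [loopDegree, monomial, LinearMap.comp_apply, LinearEquiv.coe_coe,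
    LinearEquiv.symm_apply_apply, LinearMap.rTensor_tmul, h, ← TensorProduct.smul_tmul', map_smul]

lemma lie_monomial (n m : ℤ) (x y : 𝔤) :
    ⁅monomial n x, monomial m y⁆ = monomial (n + m) ⁅x, y⁆ := by
  have h : (AddMonoidAlgebra.single n (1 : ℂ)) * AddMonoidAlgebra.single m (1 : ℂ) =
      AddMonoidAlgebra.single (n + m) (1 : ℂ) := by
    rw [AddMonoidAlgebra.single_mul_single, mul_one]
  rw [monomial, monomial, monomial, ← h]
  rfl

lemma loopCocycle_monomial (n m : ℤ) (x y : 𝔤) :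
    loopCocycle 𝔤 (monomial n x) (monomial m y) =
      if n + m = 0 then (n : ℂ) * killingForm ℂ 𝔤 x y else 0 := by
  have h := LieModule.traceForm_comm ℂ 𝔤 𝔤 x y
  have h0 : loopCocycle 𝔤 (monomial n x) (monomial m y) =
    (LieAlgebra.LoopAlgebra.toFinsupp ℂ ℤ 𝔤 (AddMonoidAlgebra.single n 1 ⊗ₜ[ℂ] x)).sum
      fun a v => a • killingForm ℂ 𝔤 (LieAlgebra.LoopAlgebra.toFinsupp ℂ ℤ 𝔤
        (AddMonoidAlgebra.single m 1 ⊗ₜ[ℂ] y) (-a)) v := rfl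
  rw [h0, LieAlgebra.LoopAlgebra.toFinsupp_single_tmul,
    LieAlgebra.LoopAlgebra.toFinsupp_single_tmul, Finsupp.sum_single_index (by simp)]
  by_cases hnm : n + m = 0
  · obtain rfl : m = -n := by omega
    simp [h]
  · rw [Finsupp.single_eq_of_ne (by omega)]
    simp [hnm]

/-- To prove an additive statement about loops it suffices to treat the elements `x ⊗ t ^ n`. -/
lemma loop_induction {P : Loop 𝔤 → Prop}
    (h0 : P 0) (hadd : ∀ a b, P a → P b → P (a + b)) (hm : ∀ n x, P (monomial n x)) (a) : P a := by
  obtain ⟨a, rfl⟩ := (ofTensor 𝔤).surjective a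
  induction a using TensorProduct.induction_on with
  | zero => rw [map_zero]; exact h0
  | add a b ha hb => rw [map_add]; exact hadd _ _ ha hb
  | tmul p x =>
    induction p using AddMonoidAlgebra.induction_linear with
    | zero => rw [TensorProduct.zero_tmul, map_zero]; exact h0
    | add p q hp hq => rw [TensorProduct.add_tmul, map_add]; exact hadd _ _ hp hq
    | single n r =>
      have : ofTensor 𝔤 (AddMonoidAlgebra.single n r ⊗ₜ[ℂ] x) = monomial n (r • x) := by
        rw [monomial, ← TensorProduct.smul_tmul, AddMonoidAlgebra.smul_single, smul_eq_mul, mul_one]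
      rw [this]; exact hm n _

lemma loopDegree_lie (a b : Loop 𝔤) :
    loopDegree 𝔤 ⁅a, b⁆ = ⁅loopDegree 𝔤 a, b⁆ + ⁅a, loopDegree 𝔤 b⁆ := by
  induction a using loop_induction with
  | h0 => simp
  | hadd a a' ha ha' => simp only [add_lie, map_add, ha, ha']; abel
  | hm n x =>
    induction b using loop_induction with
    | h0 => simp
    | hadd b b' hb hb' => simp only [lie_add, map_add, hb, hb']; abel
    | hm m y =>
      simp only [lie_monomial, loopDegree_monomial, smul_lie, lie_smul, ← add_smul]
      push_cast; rfl

lemma loopCocycle_self (a : Loop 𝔤) : loopCocycle 𝔤 a a = 0 := by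
  have skew : ∀ a b : Loop 𝔤,
      loopCocycle 𝔤 a b + loopCocycle 𝔤 b a = 0 := by
    intro a b
    induction a using loop_induction with
    | h0 => simp
    | hadd a a' ha ha' =>
      simp only [map_add, LinearMap.add_apply]; linear_combination ha + ha'
    | hm n x =>
      induction b using loop_induction with
      | h0 => simp
      | hadd b b' hb hb' =>
        simp only [map_add, LinearMap.add_apply]; linear_combination hb + hb'
      | hm m y =>
        rw [loopCocycle_monomial, loopCocycle_monomial, LieModule.traceForm_comm ℂ 𝔤 𝔤 y x,
          add_comm m n]
        split_ifs with h
        · obtain rfl : m = -n := by omega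
          push_cast; ring
        · simp
  have := skew a a
  linear_combination this / 2

lemma loopCocycle_degree (a b : Loop 𝔤) :
    loopCocycle 𝔤 (loopDegree 𝔤 a) b + loopCocycle 𝔤 a (loopDegree 𝔤 b) = 0 := by
  induction a using loop_induction with
  | h0 => simp
  | hadd a a' ha ha' => simp only [map_add, LinearMap.add_apply]; linear_combination ha + ha'
  | hm n x =>
    induction b using loop_induction with
    | h0 => simp
    | hadd b b' hb hb' => simp only [map_add]; linear_combination hb + hb'
    | hm m y =>
      simp only [loopDegree_monomial, map_smul, LinearMap.smul_apply, loopCocycle_monomial,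
        smul_eq_mul]
      split_ifs with h
      · obtain rfl : m = -n := by omega
        push_cast; ring
      · simp

lemma loopCocycle_jacobi (a b c : Loop 𝔤) :
    loopCocycle 𝔤 a ⁅b, c⁆ = loopCocycle 𝔤 ⁅a, b⁆ c + loopCocycle 𝔤 b ⁅a, c⁆ := by
  induction a using loop_induction with
  | h0 => simp
  | hadd a a' ha ha' =>
    simp only [map_add, LinearMap.add_apply, add_lie]; linear_combination ha + ha'
  | hm n x =>
    induction b using loop_induction with
    | h0 => simp
    | hadd b b' hb hb' =>
      simp only [map_add, LinearMap.add_apply, add_lie, lie_add]; linear_combination hb + hb'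
    | hm m y =>
      induction c using loop_induction with
      | h0 => simp
      | hadd c c' hc hc' =>
        simp only [map_add, lie_add]; linear_combination hc + hc'
      | hm k z =>
        have h1 : killingForm ℂ 𝔤 ⁅x, y⁆ z = killingForm ℂ 𝔤 x ⁅y, z⁆ :=
          LieModule.traceForm_apply_lie_apply ℂ 𝔤 𝔤 x y z
        have h2 : killingForm ℂ 𝔤 y ⁅x, z⁆ = - killingForm ℂ 𝔤 x ⁅y, z⁆ := by
          rw [← LieModule.traceForm_apply_lie_apply ℂ 𝔤 𝔤 y x z, ← lie_skew, map_neg,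
            LinearMap.neg_apply, h1]
        simp only [lie_monomial, loopCocycle_monomial, h1, h2]
        rw [show n + m + k = n + (m + k) by ring, show m + (n + k) = n + (m + k) by ring]
        split_ifs with h
        · push_cast; ring
        · simp

end Loop

/-- The underlying space `𝔤 ⊗ ℂ[t, t⁻¹] ⊕ ℂ c ⊕ ℂ d` of the untwisted affine Lie algebra. -/
@[ext]
structure UntwistedAffine (𝔤 : Type*) [LieRing 𝔤] [LieAlgebra ℂ 𝔤] where
  /-- The component in `𝔤 ⊗ ℂ[t, t⁻¹]`. -/
  loop : Loop 𝔤
  /-- The coefficient of `c`. -/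
  cCoeff : ℂ
  /-- The coefficient of `d`. -/
  dCoeff : ℂ

namespace UntwistedAffine

open Loop

variable {𝔤 : Type*} [LieRing 𝔤] [LieAlgebra ℂ 𝔤]

/-- The underlying space as a product; it carries the vector space structure over. -/
def equivProd : UntwistedAffine 𝔤 ≃ Loop 𝔤 × ℂ × ℂ where
  toFun X := (X.loop, X.cCoeff, X.dCoeff)
  invFun p := ⟨p.1, p.2.1, p.2.2⟩
  left_inv _ := rfl
  right_inv _ := rfl

instance : AddCommGroup (UntwistedAffine 𝔤) := equivProd.addCommGroup

instance : Module ℂ (UntwistedAffine 𝔤) := equivProd.module ℂ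

@[simp] lemma zero_loop : (0 : UntwistedAffine 𝔤).loop = 0 := rfl
@[simp] lemma zero_cCoeff : (0 : UntwistedAffine 𝔤).cCoeff = 0 := rfl
@[simp] lemma zero_dCoeff : (0 : UntwistedAffine 𝔤).dCoeff = 0 := rfl
@[simp] lemma add_loop (X Y : UntwistedAffine 𝔤) : (X + Y).loop = X.loop + Y.loop := rfl
@[simp] lemma add_cCoeff (X Y : UntwistedAffine 𝔤) : (X + Y).cCoeff = X.cCoeff + Y.cCoeff := rfl
@[simp] lemma add_dCoeff (X Y : UntwistedAffine 𝔤) : (X + Y).dCoeff = X.dCoeff + Y.dCoeff := rfl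
@[simp] lemma smul_loop (r : ℂ) (X : UntwistedAffine 𝔤) : (r • X).loop = r • X.loop := rfl
@[simp] lemma smul_cCoeff (r : ℂ) (X : UntwistedAffine 𝔤) : (r • X).cCoeff = r • X.cCoeff := rfl
@[simp] lemma smul_dCoeff (r : ℂ) (X : UntwistedAffine 𝔤) : (r • X).dCoeff = r • X.dCoeff := rfl

/-- The bracket for which `c` is central, `d` acts on the loop algebra as the degree operator, and
loops are multiplied in the loop algebra up to the multiple of `c` given by the cocycle. -/
instance : Bracket (UntwistedAffine 𝔤) (UntwistedAffine 𝔤) where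
  bracket X Y :=
    { loop := ⁅X.loop, Y.loop⁆ + X.dCoeff • loopDegree 𝔤 Y.loop - Y.dCoeff • loopDegree 𝔤 X.loop
      cCoeff := loopCocycle 𝔤 X.loop Y.loop
      dCoeff := 0 }

@[simp] lemma lie_loop (X Y : UntwistedAffine 𝔤) : ⁅X, Y⁆.loop =
    ⁅X.loop, Y.loop⁆ + X.dCoeff • loopDegree 𝔤 Y.loop - Y.dCoeff • loopDegree 𝔤 X.loop := rfl
@[simp] lemma lie_cCoeff (X Y : UntwistedAffine 𝔤) :
    ⁅X, Y⁆.cCoeff = loopCocycle 𝔤 X.loop Y.loop := rfl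
@[simp] lemma lie_dCoeff (X Y : UntwistedAffine 𝔤) : ⁅X, Y⁆.dCoeff = 0 := rfl

instance : LieRing (UntwistedAffine 𝔤) where
  add_lie X Y Z := by
    ext1
    · simp only [lie_loop, add_loop, add_dCoeff, add_lie, map_add, add_smul, smul_add]; abel
    · simp
    · simp
  lie_add X Y Z := by
    ext1
    · simp only [lie_loop, add_loop, add_dCoeff, lie_add, map_add, add_smul, smul_add]; abel
    · simp
    · simp
  lie_self X := by
    ext1
    · simp
    · simp [loopCocycle_self]
    · simp
  leibniz_lie X Y Z := by
    ext1
    · simp only [lie_loop, add_loop, lie_dCoeff, lie_add, lie_sub, add_lie, sub_lie, map_add,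
        map_sub, map_smul, smul_add, smul_sub, zero_smul, smul_lie, lie_smul, loopDegree_lie,
        leibniz_lie X.loop Y.loop Z.loop, smul_comm X.dCoeff Y.dCoeff,
        ← lie_skew Y.loop (loopDegree 𝔤 X.loop), smul_neg, smul_comm Z.dCoeff]
      abel
    · have h1 := loopCocycle_jacobi X.loop Y.loop Z.loop
      have h2 := loopCocycle_degree X.loop Z.loop
      have h3 := loopCocycle_degree X.loop Y.loop
      have h4 := loopCocycle_degree Y.loop Z.loop
      have skew : ∀ a b : Loop 𝔤,
          loopCocycle 𝔤 a b = - loopCocycle 𝔤 b a := by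
        intro a b
        have := loopCocycle_self (a + b)
        simp only [map_add, LinearMap.add_apply, loopCocycle_self] at this
        linear_combination this
      have h5 := skew Y.loop (loopDegree 𝔤 X.loop)
      simp only [lie_loop, lie_cCoeff, add_cCoeff, map_add, map_sub, map_smul,
        LinearMap.add_apply, LinearMap.sub_apply, LinearMap.smul_apply, smul_eq_mul]
      linear_combination h1 + Y.dCoeff * h2 - Z.dCoeff * h3 - X.dCoeff * h4 + Z.dCoeff * h5
    · simp

instance : LieAlgebra ℂ (UntwistedAffine 𝔤) where
  lie_smul r X Y := by
    ext1
    · simp only [lie_loop, smul_loop, smul_dCoeff, lie_smul, map_smul, smul_add, smul_sub,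
        smul_assoc, smul_comm X.dCoeff r]
    · simp
    · simp

/-- The element `x(n) = x ⊗ t ^ n`. -/
def ofLoop (n : ℤ) (x : 𝔤) : UntwistedAffine 𝔤 := ⟨monomial n x, 0, 0⟩

variable (𝔤) in
/-- The canonical central element. -/
def c : UntwistedAffine 𝔤 := ⟨0, 1, 0⟩

variable (𝔤) in
/-- The degree derivation. -/
def d : UntwistedAffine 𝔤 := ⟨0, 0, 1⟩

/-- `[x ⊗ t ^ n, y ⊗ t ^ m] = [x, y] ⊗ t ^ (n + m) + n (x, y) δ_{n + m, 0} c`. -/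
lemma lie_ofLoop_ofLoop (n m : ℤ) (x y : 𝔤) :
    ⁅ofLoop n x, ofLoop m y⁆ = ofLoop (n + m) ⁅x, y⁆ +
      (if n + m = 0 then (n : ℂ) * killingForm ℂ 𝔤 x y else 0) • c 𝔤 := by
  split_ifs with h <;> ext1 <;> simp [ofLoop, c, lie_monomial, loopCocycle_monomial, h]

/-- `[d, x ⊗ t ^ n] = n x ⊗ t ^ n`. -/
lemma lie_d_ofLoop (n : ℤ) (x : 𝔤) : ⁅d 𝔤, ofLoop n x⁆ = (n : ℂ) • ofLoop n x := by
  ext1 <;> simp [ofLoop, d, loopDegree_monomial]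

/-- `c` is central. -/
lemma lie_c (X : UntwistedAffine 𝔤) : ⁅c 𝔤, X⁆ = 0 := by
  ext1 <;> simp [c]

variable (𝔤) in
/-- The derived algebra `[𝔤̃, 𝔤̃]` of the untwisted affine Lie algebra. -/
abbrev derivedAlgebra : LieIdeal ℂ (UntwistedAffine 𝔤) :=
  ⁅(⊤ : LieIdeal ℂ (UntwistedAffine 𝔤)), (⊤ : LieIdeal ℂ (UntwistedAffine 𝔤))⁆

end UntwistedAffine

end

/-! The proof starts with the finite-dimensional algebra 𝔤. Vanishing on commuting pairs is
preserved by automorphisms, hence by the infinitesimal action of ad-nilpotent elements. Applied to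
root vectors, this forces the cocycle identity (`cyclicSum_eq_zero`). Represented through the
Killing form κ, such a form is a derivation, hence inner, so it equals κ(w, [x, y])
(`exists_eq_killingForm_lie`).

For loops, the usable pairs are those that commute in the central extension. Pairs of multiples of
one x show that x ↦ f(x(1), x(-1)) vanishes on κ-isotropic vectors, so it is a multiple of κ.
Subtracting that multiple of the cocycle leaves a form with f(x(n), x(m)) = 0
(`exists_apply_monomial_self`). Explicit commuting pairs then show that f(x(n), y(m)) depends only
on n + m (`apply_monomial_eq`), so the result for 𝔤 applies in each degree (`exists_loop_form`).

The central element contributes nothing. The values at d are forced because 𝔤 is spanned by vectors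
e with [y, e] = e (`span_lie_eq_self_eq_top`), for which d - n y(0) commutes with e(n). In the
derived algebra there is no d-component, so the loop result suffices. -/

namespace ZeroProductDetermined

open LieAlgebra LieModule

/-! ### Differentiating along one-parameter groups of automorphisms -/

section Exponential

variable {K L : Type*} [Field K] [CharZero K] [LieRing L] [LieAlgebra K L]

/-- A bilinear form invariant in the weak sense under the one-parameter group of a nilpotent
derivation satisfies the infinitesimal relation. -/
lemma apply_derivation_add_eq_zero (f : L →ₗ[K] L →ₗ[K] K)
    (hf : ∀ x y : L, ⁅x, y⁆ = 0 → f x y = 0) (D : LieDerivation K L L)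
    (hD : IsNilpotent D.toLinearMap) {x y : L} (hxy : ⁅x, y⁆ = 0) :
    f (D x) y + f x (D y) = 0 := by
  let _ : Module ℚ L := Module.compHom L (algebraMap ℚ K)
  let _ : LieAlgebra ℚ L := { lie_smul := fun q a b => lie_smul (algebraMap ℚ K q) a b }
  have hq : ∀ (q : ℚ) (a : L), q • a = (q : K) • a := fun q a => rfl
  obtain ⟨k, hk⟩ := hD
  -- The exponent k + 2 ensures that the truncated exponential sums contain the indices 0 and 1,
  -- which make up the coefficient of s in `P`.
  have hk2 : D.toLinearMap ^ (k + 2) = 0 := by rw [pow_add, hk, zero_mul]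
  let a : ℕ → ℕ → K := fun i j => ((i.factorial : K)⁻¹ * (j.factorial : K)⁻¹) *
    f ((D.toLinearMap ^ i) x) ((D.toLinearMap ^ j) y)
  let P : Polynomial K := ∑ i ∈ Finset.range (k + 2), ∑ j ∈ Finset.range (k + 2),
    Polynomial.monomial (i + j) (a i j)
  have hP : P = 0 := by
    -- The value of `P` at s is f(exp(sD) x, exp(sD) y), and exp(sD) is an automorphism, so the pair
    -- still commutes.
    refine Polynomial.funext fun s => ?_
    have hs : (s • D).toLinearMap ^ (k + 2) = 0 := by
      change (s • D.toLinearMap) ^ (k + 2) = 0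
      rw [smul_pow, hk2, smul_zero]
    have hn : IsNilpotent (s • D).toLinearMap := ⟨_, hs⟩
    have hexp : ∀ z, LieDerivation.exp (s • D) hn z = ∑ i ∈ Finset.range (k + 2),
        ((i.factorial : K)⁻¹ * s ^ i) • (D.toLinearMap ^ i) z := by
      intro z
      rw [LieDerivation.exp_map_apply, IsNilpotent.exp_eq_sum hs, LinearMap.sum_apply]
      refine Finset.sum_congr rfl fun i _ => ?_
      have : (s • D).toLinearMap = s • D.toLinearMap := rfl
      rw [this, smul_pow, LinearMap.smul_apply, LinearMap.smul_apply, hq, smul_smul]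
      push_cast; rfl
    have h0 := hf (LieDerivation.exp (s • D) hn x) (LieDerivation.exp (s • D) hn y)
      (by rw [← LieEquiv.map_lie, hxy, map_zero])
    rw [hexp, hexp] at h0
    simp only [map_sum, map_smul, LinearMap.sum_apply, LinearMap.smul_apply, smul_eq_mul] at h0
    rw [Polynomial.eval_zero, ← h0]
    simp only [P, a, Polynomial.eval_finsetSum, Polynomial.eval_monomial, Finset.mul_sum]
    rw [Finset.sum_comm]
    refine Finset.sum_congr rfl fun i _ => Finset.sum_congr rfl fun j _ => ?_
    ring
  have h1 : P.coeff 1 = a 1 0 + a 0 1 := by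
    simp only [P, Polynomial.finsetSum_coeff, Polynomial.coeff_monomial]
    rw [Finset.sum_range_succ', Finset.sum_range_succ', Finset.sum_range_succ',
      Finset.sum_range_succ', Finset.sum_range_succ']
    have h0 : ∀ i j : ℕ, i + 1 + 1 + (j + 1 + 1) ≠ 1 := by omega
    simp [Finset.sum_range_succ', h0]
  rw [hP, Polynomial.coeff_zero] at h1
  simpa [a] using h1.symm

end Exponential

/-! ### The cocycle identity and forms on Killing Lie algebras -/

section Killing

variable {K L : Type*} [Field K] [LieRing L] [LieAlgebra K L]

lemma derivation_ad_apply (z x : L) : LieDerivation.ad K L z x = ⁅z, x⁆ :=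
  LinearMap.congr_fun (LieDerivation.coe_ad_apply_eq_ad_apply (R := K) z) x

/-- The action of an element of a Lie algebra on a bilinear form (up to sign). -/
def lieForm (z : L) (f : L →ₗ[K] L →ₗ[K] K) : L →ₗ[K] L →ₗ[K] K :=
  f.comp (ad K L z) + f.compl₂ (ad K L z)

@[simp] lemma lieForm_apply (z : L) (f : L →ₗ[K] L →ₗ[K] K) (x y : L) :
    lieForm z f x y = f ⁅z, x⁆ y + f x ⁅z, y⁆ := rfl

lemma lieForm_apply_eq_zero [CharZero K] {f : L →ₗ[K] L →ₗ[K] K}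
    (hf : ∀ x y : L, ⁅x, y⁆ = 0 → f x y = 0) {z : L} (hz : IsNilpotent (ad K L z))
    (x y : L) (hxy : ⁅x, y⁆ = 0) : lieForm z f x y = 0 := by
  have h := apply_derivation_add_eq_zero f hf (LieDerivation.ad K L z)
    (by rwa [LieDerivation.coe_ad_apply_eq_ad_apply]) hxy
  rw [lieForm_apply]
  simpa only [derivation_ad_apply] using h

/-- The cyclic sum measuring the failure of the cocycle identity for a bilinear form. -/
def cyclicSum (f : L →ₗ[K] L →ₗ[K] K) (x y z : L) : K := f ⁅x, y⁆ z + f ⁅y, z⁆ x + f ⁅z, x⁆ y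

lemma cyclicSum_rotate (f : L →ₗ[K] L →ₗ[K] K) (x y z : L) :
    cyclicSum f x y z = cyclicSum f y z x := by
  simp only [cyclicSum]; ring

lemma cyclicSum_add_left (f : L →ₗ[K] L →ₗ[K] K) (x x' y z : L) :
    cyclicSum f (x + x') y z = cyclicSum f x y z + cyclicSum f x' y z := by
  simp only [cyclicSum, add_lie, lie_add, map_add, LinearMap.add_apply]; ring

lemma cyclicSum_add_mid (f : L →ₗ[K] L →ₗ[K] K) (x y y' z : L) :
    cyclicSum f x (y + y') z = cyclicSum f x y z + cyclicSum f x y' z := by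
  simp only [cyclicSum_rotate f x, cyclicSum_add_left]

lemma cyclicSum_add_right (f : L →ₗ[K] L →ₗ[K] K) (x y z z' : L) :
    cyclicSum f x y (z + z') = cyclicSum f x y z + cyclicSum f x y z' := by
  simp only [← cyclicSum_rotate f _ x, cyclicSum_add_left]

lemma form_skew {f : L →ₗ[K] L →ₗ[K] K} (hf : ∀ x y : L, ⁅x, y⁆ = 0 → f x y = 0) (x y : L) :
    f x y = - f y x := by
  have h := hf (x + y) (x + y) (lie_self _)
  simp only [map_add, LinearMap.add_apply, hf x x (lie_self _), hf y y (lie_self _)] at h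
  linear_combination h

lemma cyclicSum_swap (f : L →ₗ[K] L →ₗ[K] K)
    (x y z : L) : cyclicSum f x y z = - cyclicSum f x z y := by
  simp only [cyclicSum]
  rw [← lie_skew x y, ← lie_skew y z, ← lie_skew z x]
  simp only [map_neg, LinearMap.neg_apply]
  ring

/-- Links the action on forms to the cocycle defect: on commuting pairs the correction term drops
out, so invariance statements become vanishing of cyclic sums. -/
lemma lieForm_eq_cyclicSum {f : L →ₗ[K] L →ₗ[K] K} (hf : ∀ x y : L, ⁅x, y⁆ = 0 → f x y = 0)
    (z x y : L) : lieForm z f x y = cyclicSum f z x y + f z ⁅x, y⁆ := by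
  rw [lieForm_apply, cyclicSum, form_skew hf x, form_skew hf z ⁅x, y⁆, ← lie_skew y z]
  simp only [map_neg, LinearMap.neg_apply]
  ring

lemma cyclicSum_eq_zero_of_isNilpotent [CharZero K] {f : L →ₗ[K] L →ₗ[K] K}
    (hf : ∀ x y : L, ⁅x, y⁆ = 0 → f x y = 0) {z : L} (hz : IsNilpotent (ad K L z))
    {x y : L} (hxy : ⁅x, y⁆ = 0) : cyclicSum f z x y = 0 := by
  have h := lieForm_eq_cyclicSum hf z x y
  rwa [lieForm_apply_eq_zero hf hz x y hxy, hxy, map_zero, add_zero, eq_comm] at h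

variable [FiniteDimensional K L]

/-- A form on a Killing Lie algebra satisfying the cocycle identity factors through the bracket. -/
lemma exists_eq_killingForm_lie [IsKilling K L] {f : L →ₗ[K] L →ₗ[K] K}
    (hf : ∀ x y : L, ⁅x, y⁆ = 0 → f x y = 0) (hJ : ∀ x y z, cyclicSum f x y z = 0) :
    ∃ w : L, ∀ x y, f x y = killingForm K L w ⁅x, y⁆ := by
  have hκ := LieAlgebra.IsKilling.killingForm_nondegenerate K L
  let T : L →ₗ[K] L := LinearMap.BilinForm.symmCompOfNondegenerate f (killingForm K L) hκ
  have hT : ∀ x y, killingForm K L (T x) y = f x y := fun x y =>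
    LinearMap.BilinForm.symmCompOfNondegenerate_left_apply f hκ y x
  have hinv : ∀ x y z : L, killingForm K L ⁅x, y⁆ z = killingForm K L x ⁅y, z⁆ := fun x y z =>
    LieModule.traceForm_apply_lie_apply K L L x y z
  have hinj : ∀ a b : L, (∀ z, killingForm K L a z = killingForm K L b z) → a = b := by
    intro a b h
    rw [← sub_eq_zero]
    refine hκ.1 _ fun z => ?_
    rw [map_sub, LinearMap.sub_apply, h, sub_self]
  -- By invariance and nondegeneracy of the Killing form, the cocycle identity for f is the Leibniz
  -- rule for `T`.
  let D : LieDerivation K L L :=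
    { toLinearMap := T
      leibniz' := fun x y => by
        refine hinj _ _ fun z => ?_
        have h := hJ x y z
        rw [cyclicSum, form_skew hf ⁅y, z⁆, ← lie_skew z x, form_skew hf _ y] at h
        rw [hT, map_sub, LinearMap.sub_apply, ← lie_skew x (T y), ← lie_skew y (T x)]
        simp only [map_neg, LinearMap.neg_apply, hinv, hT] at h ⊢
        linear_combination h }
  obtain ⟨w, hw⟩ := LieDerivation.IsKilling.exists_eq_ad D
  refine ⟨w, fun x y => ?_⟩
  have : T x = ⁅w, x⁆ := by
    rw [← derivation_ad_apply (K := K), hw]; rfl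
  rw [← hT, this, hinv]

/-! ### Root space analysis of the cyclic sum -/

open LieAlgebra.IsKilling

variable {H : LieSubalgebra K L} [H.IsCartanSubalgebra]

/-- An additive property that holds on a Cartan subalgebra and on root vectors holds everywhere. -/
lemma root_induction [IsAlgClosed K] {P : L → Prop} (hH : ∀ h : H, P h)
    (hroot : ∀ α : Weight K H L, α.IsNonZero → ∀ e ∈ rootSpace H α, P e)
    (hadd : ∀ x y, P x → P y → P (x + y)) (x : L) : P x := by
  have hx : x ∈ ⨆ χ : Weight K H L, genWeightSpace L χ := by
    simp [iSup_genWeightSpace_eq_top' K H L]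
  induction hx using LieSubmodule.iSup_induction' with
  | zero => simpa using hH 0
  | add _ _ _ _ h1 h2 => exact hadd _ _ h1 h2
  | mem χ e he =>
    by_cases hχ : χ.IsZero
    · have he' : e ∈ rootSpace H (0 : H → K) := by rw [← hχ.eq]; exact he
      rw [rootSpace_zero_eq] at he'
      exact hH ⟨e, he'⟩
    · exact hroot χ hχ e he

lemma isNilpotent_ad_root [CharZero K] [IsAlgClosed K] {α : Weight K H L} (hα : α.IsNonZero)
    {e : L} (he : e ∈ rootSpace H α) : IsNilpotent (ad K L e) :=
  LieAlgebra.isNilpotent_ad_of_mem_rootSpace H hα he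

lemma lie_cartan [IsKilling K L] (h h' : H) : ⁅(h : L), (h' : L)⁆ = 0 := by
  rw [← LieSubalgebra.coe_bracket, trivial_lie_zero, ZeroMemClass.coe_zero]

variable [CharZero K] [IsAlgClosed K] [IsKilling K L]

lemma lie_root (h : H) {α : H → K} {e : L} (he : e ∈ rootSpace H α) :
    ⁅(h : L), e⁆ = α h • e := lie_eq_smul_of_mem_rootSpace he h

lemma lie_same_root {α : Weight K H L} (hα : α.IsNonZero) {e e' : L}
    (he : e ∈ rootSpace H α) (he' : e' ∈ rootSpace H α) : ⁅e, e'⁆ = 0 := by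
  have h := lie_mem_genWeightSpace_of_mem_genWeightSpace he he'
  rw [← two_nsmul] at h
  have h' : ⁅e, e'⁆ ∈ rootSpace H (2 • (α : H → K)) := h
  rw [rootSpace_two_smul α hα] at h'
  simpa using h'

/-- If β vanishes on the kernel of α it is a multiple of α, and proportional roots agree up to sign.
-/
lemma eq_or_eq_neg_or_exists {α β : Weight K H L} (hβ : β.IsNonZero) :
    β = α ∨ β = -α ∨ ∃ h : H, α h = 0 ∧ β h ≠ 0 := by
  by_contra! hc
  obtain ⟨h1, h2, h3⟩ := hc
  have hmem : (β.toLinear) ∈ Submodule.span K (Set.range fun _ : Unit => α.toLinear) := by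
    refine mem_span_of_iInf_ker_le_ker ?_
    intro h hh
    simp only [iInf_const, LinearMap.mem_ker] at hh ⊢
    exact h3 h hh
  rw [Set.range_const, Submodule.mem_span_singleton] at hmem
  obtain ⟨k, hk⟩ := hmem
  rcases eq_neg_or_eq_of_eq_smul α β hβ k
    (funext fun h => (LinearMap.congr_fun hk h).symm) with h | h
  · exact h2 h
  · exact h1 h

/-- The cyclic sum dies when one entry is a root vector and the other two commute. This leaves two
root vectors beside h: equal or opposite roots are computed directly, and otherwise h is split into
pieces each commuting with one root vector. -/
lemma cyclicSum_cartan {f : L →ₗ[K] L →ₗ[K] K} (hf : ∀ x y : L, ⁅x, y⁆ = 0 → f x y = 0)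
    (h : H) (y z : L) : cyclicSum f h y z = 0 := by
  induction y using root_induction (H := H) with
  | hadd y y' hy hy' =>
    rw [cyclicSum_add_mid, hy, hy', add_zero]
  | hH h' =>
    induction z using root_induction (H := H) with
    | hadd z z' hz hz' =>
      rw [cyclicSum_add_right, hz, hz', add_zero]
    | hH h'' => simp [cyclicSum, lie_cartan]
    | hroot α hα e he =>
      rw [← cyclicSum_rotate]
      exact cyclicSum_eq_zero_of_isNilpotent hf (isNilpotent_ad_root hα he) (lie_cartan h h')
  | hroot α hα e he =>
    induction z using root_induction (H := H) with
    | hadd z z' hz hz' =>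
      rw [cyclicSum_add_right, hz, hz', add_zero]
    | hH h'' =>
      rw [cyclicSum_rotate]
      exact cyclicSum_eq_zero_of_isNilpotent hf (isNilpotent_ad_root hα he) (lie_cartan h'' h)
    | hroot β hβ e' he' =>
      rcases eq_or_eq_neg_or_exists (α := α) hβ with rfl | rfl | ⟨k, hk, hk'⟩
      · have h0 := lie_same_root hα he he'
        rw [cyclicSum, h0, lie_root h he, ← lie_skew, lie_root h he']
        simp [hf _ _ h0, form_skew hf e' e]
      · have h0 : f ⁅e, e'⁆ h = 0 := by
          rw [lie_eq_killingForm_smul_of_mem_rootSpace_of_mem_rootSpace_neg he he', map_smul,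
            LinearMap.smul_apply, hf _ _ (lie_cartan _ _), smul_zero]
        rw [cyclicSum, h0, lie_root h he, ← lie_skew, lie_root h he']
        simp [form_skew hf e' e]
      -- The first summand is killed by α and commutes with e; the second is killed by β and
      -- commutes with e'.
      · have hdecomp : (h : L) = ((β h / β k) • k : H) + (h - (β h / β k) • k : H) := by simp
        have h1 : cyclicSum f ((β h / β k) • k : H) e e' = 0 := by
          rw [← cyclicSum_rotate]
          refine cyclicSum_eq_zero_of_isNilpotent hf (isNilpotent_ad_root hβ he') ?_
          rw [lie_root _ he, map_smul, hk, smul_zero, zero_smul]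
        have h2 : cyclicSum f (h - (β h / β k) • k : H) e e' = 0 := by
          rw [cyclicSum_rotate]
          refine cyclicSum_eq_zero_of_isNilpotent hf (isNilpotent_ad_root hα he) ?_
          rw [← lie_skew, lie_root _ he', map_sub, map_smul, smul_eq_mul, div_mul_cancel₀ _ hk',
            sub_self, zero_smul, neg_zero]
        rw [hdecomp, cyclicSum_add_left, h1, h2, add_zero]

/-- Acting on f by a and then by b still gives a form vanishing on commuting pairs. At the pair (h,
c) its value is -β(h) times the cyclic sum, since cyclic sums with a Cartan entry vanish. -/
lemma cyclicSum_root_of_exists {f : L →ₗ[K] L →ₗ[K] K}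
    (hf : ∀ x y : L, ⁅x, y⁆ = 0 → f x y = 0) {α β γ : Weight K H L} (hα : α.IsNonZero)
    (hβ : β.IsNonZero) {a b c : L} (ha : a ∈ rootSpace H α) (hb : b ∈ rootSpace H β)
    (hc : c ∈ rootSpace H γ) {h : H} (hγ : γ h = 0) (hβh : β h ≠ 0) :
    cyclicSum f a b c = 0 := by
  have hf' := lieForm_apply_eq_zero hf (isNilpotent_ad_root hα ha)
  have hhc : ⁅(h : L), c⁆ = 0 := by rw [lie_root h hc, hγ, zero_smul]
  have key := lieForm_apply_eq_zero hf' (isNilpotent_ad_root hβ hb) h c hhc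
  have hhb : ⁅b, (h : L)⁆ = -(β h • b) := by rw [← lie_skew, lie_root h hb]
  have hhbc : ⁅(h : L), ⁅b, c⁆⁆ = β h • ⁅b, c⁆ := by
    rw [leibniz_lie, hhc, lie_zero, add_zero, lie_root h hb, smul_lie]
  have h0 : cyclicSum f a h ⁅b, c⁆ = 0 := by
    rw [cyclicSum_rotate, cyclicSum_cartan hf]
  rw [lieForm_apply, lieForm_eq_cyclicSum hf a h, h0, hhbc, hhb, map_neg, LinearMap.neg_apply,
    map_smul, LinearMap.smul_apply, lieForm_eq_cyclicSum hf, map_smul] at key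
  simp only [smul_eq_mul] at key
  have : β h * cyclicSum f a b c = 0 := by linear_combination -key
  exact (mul_eq_zero.mp this).resolve_left hβh

/-- For three root vectors, either two belong to the same root and commute, or α or β is independent
of γ and `cyclicSum_root_of_exists` applies. -/
lemma cyclicSum_eq_zero (H : LieSubalgebra K L) [H.IsCartanSubalgebra]
    {f : L →ₗ[K] L →ₗ[K] K} (hf : ∀ x y : L, ⁅x, y⁆ = 0 → f x y = 0) (x y z : L) :
    cyclicSum f x y z = 0 := by
  induction x using root_induction (H := H) with
  | hadd x x' hx hx' => rw [cyclicSum_add_left, hx, hx', add_zero]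
  | hH h => exact cyclicSum_cartan hf h y z
  | hroot α hα a ha =>
  induction y using root_induction (H := H) with
  | hadd y y' hy hy' =>
    rw [cyclicSum_add_mid, hy, hy', add_zero]
  | hH h => rw [cyclicSum_rotate, cyclicSum_cartan hf]
  | hroot β hβ b hb =>
  induction z using root_induction (H := H) with
  | hadd z z' hz hz' =>
    rw [cyclicSum_add_right, hz, hz', add_zero]
  | hH h => rw [← cyclicSum_rotate, cyclicSum_cartan hf]
  | hroot γ hγ c hc =>
  have same : ∀ {δ : Weight K H L} {u v w : L}, IsNilpotent (ad K L u) → δ.IsNonZero →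
      v ∈ rootSpace H δ → w ∈ rootSpace H δ → cyclicSum f u v w = 0 := fun hu hδ hv hw =>
    cyclicSum_eq_zero_of_isNilpotent hf hu (lie_same_root hδ hv hw)
  have na := isNilpotent_ad_root hα ha
  have nb := isNilpotent_ad_root hβ hb
  have nc := isNilpotent_ad_root hγ hc
  rcases eq_or_eq_neg_or_exists (α := γ) hβ with rfl | rfl | ⟨h, h1, h2⟩
  · exact same na hβ hb hc
  · rcases eq_or_eq_neg_or_exists (α := γ) hα with rfl | rfl | ⟨h, h1, h2⟩
    · rw [cyclicSum_rotate]
      exact same nb hα hc ha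
    · rw [← cyclicSum_rotate]
      exact same nc hα ha hb
    · rw [cyclicSum_rotate, cyclicSum_swap,
        cyclicSum_root_of_exists hf hβ hα hb ha hc h1 h2, neg_zero]
  · exact cyclicSum_root_of_exists hf hα hβ ha hb hc h1 h2

/-- Every form on a Killing Lie algebra over an algebraically closed field of characteristic zero
that vanishes on commuting pairs factors through the bracket. -/
theorem exists_eq_apply_lie_of_isKilling {f : L →ₗ[K] L →ₗ[K] K}
    (hf : ∀ x y : L, ⁅x, y⁆ = 0 → f x y = 0) :
    ∃ w : L, ∀ x y, f x y = killingForm K L w ⁅x, y⁆ := by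
  obtain ⟨u, hu⟩ := LieAlgebra.exists_isCartanSubalgebra_engel K L
  exact exists_eq_killingForm_lie hf (cyclicSum_eq_zero (LieSubalgebra.engel K u) hf)

/-- A Killing Lie algebra is spanned by the elements `e` with `⁅y, e⁆ = e` for some `y`. -/
theorem span_lie_eq_self_eq_top :
    Submodule.span K {e : L | ∃ y : L, ⁅y, e⁆ = e} = ⊤ := by
  obtain ⟨u, hu⟩ := LieAlgebra.exists_isCartanSubalgebra_engel K L
  let H := LieSubalgebra.engel K u
  let U := Submodule.span K {e : L | ∃ y : L, ⁅y, e⁆ = e}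
  have hroot : ∀ α : Weight K H L, α.IsNonZero → ∀ e ∈ rootSpace H α, e ∈ U := by
    intro α hα e he
    obtain ⟨h, hh⟩ : ∃ h, α h ≠ 0 := by
      by_contra! hc
      exact hα (funext hc)
    refine Submodule.subset_span ⟨((α h)⁻¹ • h : H), ?_⟩
    rw [lie_root _ he, ← Weight.toLinear_apply, map_smul, Weight.toLinear_apply, smul_eq_mul,
      inv_mul_cancel₀ hh, one_smul]
  have hcoroot : ∀ α : Weight K H L, α.IsNonZero → (coroot α : L) ∈ U := by
    intro α hα
    obtain ⟨h, e, f, ht, he, hf⟩ := exists_isSl2Triple_of_weight_isNonZero hα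
    rw [← ht.h_eq_coroot hα he hf]
    have heU := hroot α hα e he
    have hfU := hroot (-α) hα.neg f hf
    -- The coroot h cannot satisfy [y, h] = h, being ad-semisimple. But -(e + f)/2 has h + e - f as
    -- an eigenvector of eigenvalue 1, and e, f are already in the span.
    have hsum : h + e - f ∈ U := by
      refine Submodule.subset_span ⟨-((2 : K)⁻¹ • (e + f)), ?_⟩
      have h1 : ⁅e, h⁆ = -((2 : K) • e) := by rw [← lie_skew, ht.lie_h_e_smul K]
      have h2 : ⁅f, h⁆ = (2 : K) • f := by
        rw [← lie_skew, ht.lie_h_f_nsmul, neg_neg, ← Nat.cast_smul_eq_nsmul K]; norm_num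
      have h3 : ⁅f, e⁆ = -h := by rw [← lie_skew, ht.lie_e_f]
      simp only [neg_lie, smul_lie, add_lie, lie_sub, lie_add, h1, h2, h3, ht.lie_e_f, lie_self]
      module
    have : h = (h + e - f) - e + f := by abel
    rw [this]
    exact add_mem (sub_mem hsum heU) hfU
  rw [eq_top_iff]
  rintro x -
  induction x using root_induction (H := H) with
  | hadd x y hx hy => exact add_mem hx hy
  | hroot α hα e he => exact hroot α hα e he
  | hH h =>
    have hh : h ∈ Submodule.span K (Set.range (rootSystem H).coroot) := by
      rw [RootPairing.IsRootSystem.span_coroot_eq_top]; trivial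
    induction hh using Submodule.span_induction with
    | zero => simp
    | add x y _ _ hx hy => exact add_mem hx hy
    | smul r x _ hx => exact Submodule.smul_mem _ r hx
    | mem x hx =>
      obtain ⟨α, rfl⟩ := hx
      exact hcoroot α.1 ((Finset.mem_filter.mp α.2).2)

end Killing

/-! ### Quadratic forms vanishing on an isotropic cone -/

/-- A bilinear form whose quadratic form vanishes on the isotropic vectors of a nondegenerate
symmetric form has a quadratic form proportional to that of the latter. -/
lemma exists_apply_self_eq_mul {K V : Type*} [Field K] [CharZero K] [IsAlgClosed K]
    [AddCommGroup V] [Module K V] [FiniteDimensional K V] {κ B : LinearMap.BilinForm K V}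
    (hsymm : LinearMap.IsSymm κ) (hκ : κ.Nondegenerate) (hB : ∀ x, κ x x = 0 → B x x = 0) :
    ∃ μ : K, ∀ x, B x x = μ * κ x x := by
  let _ : Invertible (2 : K) := invertibleOfNonzero two_ne_zero
  obtain ⟨v, hv⟩ := LinearMap.BilinForm.exists_orthogonal_basis hsymm
  have hk : ∀ i, κ (v i) (v i) ≠ 0 := hv.not_isOrtho_basis_self_of_separatingLeft hκ.1
  have hort : ∀ i j, i ≠ j → κ (v i) (v j) = 0 := fun i j hij => hv hij
  have key : ∀ i j, i ≠ j → B (v i) (v j) + B (v j) (v i) = 0 ∧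
      B (v i) (v i) * κ (v j) (v j) = B (v j) (v j) * κ (v i) (v i) := by
    intro i j hij
    -- With this s both v i ± s v j are isotropic. The difference of the two values of B isolates
    -- the symmetrized cross term, their sum compares the diagonal entries.
    obtain ⟨s, hs⟩ := IsAlgClosed.exists_pow_nat_eq (-κ (v i) (v i) / κ (v j) (v j)) two_pos
    have hs' : s ^ 2 * κ (v j) (v j) = - κ (v i) (v i) := by
      rw [hs, div_mul_cancel₀ _ (hk j)]
    have hs0 : s ≠ 0 := by
      rintro rfl
      refine hk i ?_
      linear_combination hs'
    have h1 := hB (v i + s • v j) (by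
      simp only [map_add, map_smul, LinearMap.add_apply, LinearMap.smul_apply, smul_eq_mul,
        hort i j hij, hort j i hij.symm]
      linear_combination hs')
    have h2 := hB (v i - s • v j) (by
      simp only [map_sub, map_smul, LinearMap.sub_apply, LinearMap.smul_apply, smul_eq_mul,
        hort i j hij, hort j i hij.symm]
      linear_combination hs')
    simp only [map_add, map_sub, map_smul, LinearMap.add_apply, LinearMap.sub_apply,
      LinearMap.smul_apply, smul_eq_mul] at h1 h2
    constructor
    · have : (2 * s) * (B (v i) (v j) + B (v j) (v i)) = 0 := by linear_combination h1 - h2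
      exact (mul_eq_zero.mp this).resolve_left (mul_ne_zero two_ne_zero hs0)
    · linear_combination (κ (v j) (v j) / 2) * (h1 + h2) - B (v j) (v j) * hs'
  obtain ⟨μ, hμ⟩ : ∃ μ : K, ∀ i, B (v i) (v i) = μ * κ (v i) (v i) := by
    rcases isEmpty_or_nonempty (Fin (Module.finrank K V)) with h | ⟨⟨i⟩⟩
    · exact ⟨0, fun i => h.elim i⟩
    · refine ⟨B (v i) (v i) / κ (v i) (v i), fun j => ?_⟩
      rcases eq_or_ne i j with rfl | hij
      · rw [div_mul_cancel₀ _ (hk i)]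
      · rw [div_mul_eq_mul_div, eq_div_iff (hk i), (key i j hij).2]
  refine ⟨μ, fun x => ?_⟩
  have hC : B + B.flip = (2 * μ) • κ := by
    refine LinearMap.BilinForm.ext_basis v fun i j => ?_
    simp only [LinearMap.add_apply, LinearMap.BilinForm.flip_apply, LinearMap.smul_apply, smul_eq_mul]
    rcases eq_or_ne i j with rfl | hij
    · rw [hμ]; ring
    · rw [(key i j hij).1, hort i j hij, mul_zero]
  have h := LinearMap.congr_fun (LinearMap.congr_fun hC x) x
  simp only [LinearMap.add_apply, LinearMap.BilinForm.flip_apply, LinearMap.smul_apply, smul_eq_mul] at h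
  linear_combination h / 2

open Loop

/-! ### Forms on the loop algebra -/

section LoopForms

variable {𝔤 : Type*} [LieRing 𝔤] [LieAlgebra ℂ 𝔤]

/-- The linear map `x ↦ x ⊗ t ^ n`. -/
noncomputable def monomialLinear (n : ℤ) : 𝔤 →ₗ[ℂ] Loop 𝔤 :=
  (ofTensor 𝔤).toLinearMap ∘ₗ TensorProduct.mk ℂ _ 𝔤 (AddMonoidAlgebra.single n 1)

lemma monomialLinear_apply (n : ℤ) (x : 𝔤) : monomialLinear n x = monomial n x := rfl

lemma monomial_zero (n : ℤ) : monomial n (0 : 𝔤) = 0 := (monomialLinear n).map_zero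

lemma monomial_neg (n : ℤ) (x : 𝔤) : monomial n (-x) = -monomial n x :=
  (monomialLinear n).map_neg x

lemma monomial_add (n : ℤ) (x y : 𝔤) : monomial n (x + y) = monomial n x + monomial n y :=
  (monomialLinear n).map_add x y

lemma loop_linear_ext {f g : Loop 𝔤 →ₗ[ℂ] ℂ} (h : ∀ n x, f (monomial n x) = g (monomial n x))
    (a : Loop 𝔤) : f a = g a := by
  induction a using loop_induction with
  | h0 => simp
  | hadd a b ha hb => rw [map_add, map_add, ha, hb]
  | hm n x => exact h n x

lemma loop_bilinear_ext {f g : Loop 𝔤 →ₗ[ℂ] Loop 𝔤 →ₗ[ℂ] ℂ}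
    (h : ∀ n x m y, f (monomial n x) (monomial m y) = g (monomial n x) (monomial m y))
    (a b : Loop 𝔤) : f a b = g a b := by
  refine loop_linear_ext (f := f.flip b) (g := g.flip b) (fun n x => ?_) a
  exact loop_linear_ext (h n x) b

/-- Linear functionals on the loop algebra are given by a family of functionals on `𝔤`. -/
lemma exists_loop_functional (φ : ℤ → 𝔤 →ₗ[ℂ] ℂ) :
    ∃ Φ : Loop 𝔤 →ₗ[ℂ] ℂ, ∀ n x, Φ (monomial n x) = φ n x := by
  refine ⟨(Finsupp.lsum ℂ φ) ∘ₗ (LieAlgebra.LoopAlgebra.toFinsupp ℂ ℤ 𝔤).toLinearMap ∘ₗ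
    (ofTensor 𝔤).symm.toLinearMap, fun n x => ?_⟩
  have h : LieAlgebra.LoopAlgebra.toFinsupp ℂ ℤ 𝔤 ((ofTensor 𝔤).symm (monomial n x)) =
      Finsupp.single n x := LieAlgebra.LoopAlgebra.toFinsupp_single_tmul ℂ ℤ 𝔤 n x
  simp only [LinearMap.comp_apply, LinearEquiv.coe_coe]
  erw [h]
  simp

variable {f : Loop 𝔤 →ₗ[ℂ] Loop 𝔤 →ₗ[ℂ] ℂ}

lemma apply_monomial_self_of_ne
    (hf : ∀ a b, ⁅a, b⁆ = 0 → loopCocycle 𝔤 a b = 0 → f a b = 0) {n m : ℤ} (h : n + m ≠ 0) (x : 𝔤) :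
    f (monomial n x) (monomial m x) = 0 := by
  refine hf _ _ ?_ ?_
  · rw [lie_monomial, lie_self, monomial_zero]
  · rw [loopCocycle_monomial, if_neg h]

/-- Multiples of a single x commute as loops, and the coefficient n in x(-n) - n x(-1) cancels the
cocycle against x(n) + x(1). The case n = 1 is separate because its cross terms lie in total degree
0. -/
lemma apply_monomial_self_neg
    (hf : ∀ a b, ⁅a, b⁆ = 0 → loopCocycle 𝔤 a b = 0 → f a b = 0) (n : ℤ) (x : 𝔤) :
    f (monomial n x) (monomial (-n) x) = n * f (monomial 1 x) (monomial (-1) x) := by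
  rcases eq_or_ne n 1 with rfl | hn
  · simp
  have h1 : n + -1 ≠ 0 := by omega
  have h2 : 1 + -n ≠ 0 := by omega
  have h := hf (monomial n x + monomial 1 x) (monomial (-n) x - (n : ℂ) • monomial (-1) x)
    (by simp [lie_monomial, monomial_zero])
    (by
      simp only [map_add, map_sub, map_smul, LinearMap.add_apply, loopCocycle_monomial, smul_eq_mul,
        if_neg h1, if_neg h2, add_neg_cancel, if_true]
      push_cast; ring)
  simp only [map_add, map_sub, map_smul, LinearMap.add_apply, smul_eq_mul,
    apply_monomial_self_of_ne hf h1, apply_monomial_self_of_ne hf h2] at h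
  linear_combination h

/-- The restriction of the form to monomials with equal coefficients is a multiple of the
cocycle. -/
lemma exists_apply_monomial_self [FiniteDimensional ℂ 𝔤] [LieAlgebra.IsKilling ℂ 𝔤]
    (hf : ∀ a b, ⁅a, b⁆ = 0 → loopCocycle 𝔤 a b = 0 → f a b = 0) :
    ∃ μ : ℂ, ∀ (n m : ℤ) (x : 𝔤), f (monomial n x) (monomial m x) =
      μ * loopCocycle 𝔤 (monomial n x) (monomial m x) := by
  obtain ⟨μ, hμ⟩ := exists_apply_self_eq_mul (κ := killingForm ℂ 𝔤)
    (B := f.compl₁₂ (monomialLinear 1) (monomialLinear (-1)))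
    (LieModule.traceForm_isSymm ℂ 𝔤 𝔤) (LieAlgebra.IsKilling.killingForm_nondegenerate ℂ 𝔤)
    (fun x hx => hf _ _ (by simp [monomialLinear_apply, lie_monomial, monomial_zero])
      (by simp [monomialLinear_apply, loopCocycle_monomial, hx]))
  refine ⟨μ, fun n m x => ?_⟩
  rw [loopCocycle_monomial]
  split_ifs with h
  · obtain rfl : m = -n := by omega
    rw [apply_monomial_self_neg hf]
    have := hμ x
    simp only [LinearMap.compl₁₂_apply, monomialLinear_apply] at this
    rw [this]; ring
  · rw [apply_monomial_self_of_ne hf h, mul_zero]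

/-! ### Reduction to total degree once f(x(n), x(m)) = 0 -/

section Symmetric

lemma apply_monomial_swap (hs : ∀ n m x, f (monomial n x) (monomial m x) = 0) (n m : ℤ) (x y : 𝔤) :
    f (monomial n y) (monomial m x) = - f (monomial n x) (monomial m y) := by
  have h := hs n m (x + y)
  simp only [monomial_add, map_add, LinearMap.add_apply, hs] at h
  linear_combination h

lemma apply_monomial_comm (hf : ∀ a b, ⁅a, b⁆ = 0 → loopCocycle 𝔤 a b = 0 → f a b = 0)
    (hs : ∀ n m x, f (monomial n x) (monomial m x) = 0) (n m : ℤ) (x y : 𝔤) :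
    f (monomial n x) (monomial m y) = f (monomial m x) (monomial n y) := by
  have hself : ∀ a, f a a = 0 := fun a => hf a a (lie_self a) (loopCocycle_self a)
  have h := hself (monomial n x + monomial m y)
  simp only [map_add, LinearMap.add_apply, hself] at h
  linear_combination h - apply_monomial_swap hs m n x y

/-- The pair x(0) + y(n), x(m) + y(n + m) commutes. Its cocycle could only see y(n) against y(n + m)
when 2n + m = 0; interchanging n and m avoids that case. -/
lemma apply_monomial_of_ne (hf : ∀ a b, ⁅a, b⁆ = 0 → loopCocycle 𝔤 a b = 0 → f a b = 0)
    (hs : ∀ n m x, f (monomial n x) (monomial m x) = 0) {n m : ℤ} (h1 : n + m ≠ 0)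
    (x y : 𝔤) : f (monomial n x) (monomial m y) = f (monomial 0 x) (monomial (n + m) y) := by
  have key : ∀ n m : ℤ, n + m ≠ 0 → 2 * n + m ≠ 0 →
      f (monomial n x) (monomial m y) = f (monomial 0 x) (monomial (n + m) y) := by
    intro n m h1 h2
    have h3 : n + (n + m) ≠ 0 := by omega
    have h := hf (monomial 0 x + monomial n y) (monomial m x + monomial (n + m) y)
      (by
        simp only [lie_add, add_lie, lie_monomial, lie_self, monomial_zero, zero_add, add_zero]
        rw [← lie_skew y x, monomial_neg, add_comm n m]
        abel)
      (by simp [loopCocycle_monomial, h1, h3])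
    simp only [map_add, LinearMap.add_apply, hs, apply_monomial_swap hs n m x y] at h
    linear_combination -h
  rcases eq_or_ne (2 * n + m) 0 with h2 | h2
  · rw [apply_monomial_comm hf hs, add_comm n m, key m n (by omega) (by omega)]
  · exact key n m h1 h2

lemma apply_monomial_neg_of_ne (hf : ∀ a b, ⁅a, b⁆ = 0 → loopCocycle 𝔤 a b = 0 → f a b = 0)
    (hs : ∀ n m x, f (monomial n x) (monomial m x) = 0) {m : ℤ} (h0 : m ≠ 0) (h1 : m ≠ 1)
    (h2 : m ≠ 2) (x y : 𝔤) :
    f (monomial m x) (monomial (-m) y) =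
      (1 - m) * f (monomial 0 x) (monomial 0 y) + m * f (monomial 1 x) (monomial (-1) y) := by
  have e1 : m + -1 ≠ 0 := by omega
  have e2 : 1 + -m ≠ 0 := by omega
  have e3 : m + (m - 1) ≠ 0 := by omega
  have e4 : m + (1 - m) ≠ 0 := by omega
  have e5 : 1 + (m - 1) ≠ 0 := by omega
  have e6 : 1 + (1 - m) ≠ 0 := by omega
  -- The factor -m at x(-1) cancels the cocycle of y(m) with x(-m); the y-terms in the second entry,
  -- bracketed with x(0), cancel the remaining brackets. The excluded m are those where another pair
  -- of exponents would sum to 0.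
  have h := hf (monomial 0 x + (monomial m y + monomial 1 y))
    (monomial (-m) x - (m : ℂ) • monomial (-1) x + ((1 - m : ℂ) • monomial 0 y
      - (m : ℂ) • monomial (m - 1) y + monomial (1 - m) y))
    (by
      simp only [lie_add, add_lie, lie_sub, lie_smul, lie_monomial, lie_self, monomial_zero,
        zero_add, add_zero]
      simp only [← lie_skew y x, monomial_neg, add_neg_cancel, ← sub_eq_add_neg m 1,
        ← sub_eq_add_neg 1 m]
      module)
    (by
      simp only [map_add, map_sub, map_smul, LinearMap.add_apply, loopCocycle_monomial, smul_eq_mul,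
        if_neg e1, if_neg e2, if_neg e3, if_neg e4, if_neg e5, if_neg e6, add_neg_cancel, if_true,
        add_zero, if_neg h0, if_neg one_ne_zero]
      push_cast
      simp only [zero_mul, ite_self]
      ring)
  simp only [map_add, map_sub, map_smul, LinearMap.add_apply, smul_eq_mul, hs,
    apply_monomial_swap hs _ _ x y] at h
  have g1 := apply_monomial_of_ne hf hs e1 x y
  have g2 := apply_monomial_of_ne hf hs e2 x y
  rw [← sub_eq_add_neg] at g1 g2
  linear_combination -h + m * g1 - g2

lemma apply_monomial_eq (hf : ∀ a b, ⁅a, b⁆ = 0 → loopCocycle 𝔤 a b = 0 → f a b = 0)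
    (hs : ∀ n m x, f (monomial n x) (monomial m x) = 0) (n m : ℤ) (x y : 𝔤) :
    f (monomial n x) (monomial m y) = f (monomial 0 x) (monomial (n + m) y) := by
  rcases ne_or_eq (n + m) 0 with h | h
  · exact apply_monomial_of_ne hf hs h x y
  obtain rfl : m = -n := by omega
  rw [add_neg_cancel]
  -- Taking m = -1 and using symmetry in the exponents gives twice the desired equation.
  have h1 : f (monomial 1 x) (monomial (-1) y) = f (monomial 0 x) (monomial 0 y) := by
    have h := apply_monomial_neg_of_ne hf hs (m := -1) (by decide) (by decide) (by decide) x y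
    rw [neg_neg, apply_monomial_comm hf hs] at h
    push_cast at h
    linear_combination h / 2
  have h3 : ∀ m : ℤ, m ≠ 0 → m ≠ 1 → m ≠ 2 →
      f (monomial m x) (monomial (-m) y) = f (monomial 0 x) (monomial 0 y) := by
    intro m m0 m1 m2
    rw [apply_monomial_neg_of_ne hf hs m0 m1 m2, h1]; ring
  by_cases n0 : n = 0
  · subst n0; simp
  by_cases n1 : n = 1
  · subst n1; exact h1
  by_cases n2 : n = 2
  · subst n2
    rw [apply_monomial_comm hf hs]
    exact h3 (-2) (by decide) (by decide) (by decide)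
  exact h3 n n0 n1 n2

end Symmetric

/-- A form on the loop algebra vanishing on pairs that commute in the central extension is the sum
of a form factoring through the bracket and a multiple of the cocycle. -/
theorem exists_loop_form [FiniteDimensional ℂ 𝔤] [LieAlgebra.IsKilling ℂ 𝔤]
    (hf : ∀ a b, ⁅a, b⁆ = 0 → loopCocycle 𝔤 a b = 0 → f a b = 0) :
    ∃ (Φ : Loop 𝔤 →ₗ[ℂ] ℂ) (μ : ℂ), ∀ a b, f a b = Φ ⁅a, b⁆ + μ * loopCocycle 𝔤 a b := by
  obtain ⟨μ, hμ⟩ := exists_apply_monomial_self hf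
  let g : Loop 𝔤 →ₗ[ℂ] Loop 𝔤 →ₗ[ℂ] ℂ := f - μ • loopCocycle 𝔤
  have hg : ∀ a b, g a b = f a b - μ * loopCocycle 𝔤 a b := fun a b => rfl
  have hgf : ∀ a b, ⁅a, b⁆ = 0 → loopCocycle 𝔤 a b = 0 → g a b = 0 := fun a b h1 h2 => by
    rw [hg, hf a b h1 h2, h2, mul_zero, sub_zero]
  have hgs : ∀ n m x, g (monomial n x) (monomial m x) = 0 := fun n m x => by
    rw [hg, hμ, sub_self]
  -- With first exponent 0 the cocycle vanishes identically, so commuting in 𝔤 is enough.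
  have hw : ∀ k : ℤ, ∃ w : 𝔤, ∀ x y,
      g (monomial 0 x) (monomial k y) = killingForm ℂ 𝔤 w ⁅x, y⁆ := fun k =>
    exists_eq_apply_lie_of_isKilling (f := g.compl₁₂ (monomialLinear 0) (monomialLinear k))
      fun x y hxy => hgf _ _ (by simp [monomialLinear_apply, lie_monomial, hxy, monomial_zero])
        (by simp [monomialLinear_apply, loopCocycle_monomial])
  choose w hw using hw
  obtain ⟨Φ, hΦ⟩ := exists_loop_functional fun n => killingForm ℂ 𝔤 (w n)
  refine ⟨Φ, μ, fun a b => ?_⟩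
  have key : g a b = Φ ⁅a, b⁆ :=
    loop_bilinear_ext (f := g) (g := LinearMap.mk₂ ℂ (fun a b => Φ ⁅a, b⁆) (by simp) (by simp) (by simp) (by simp))
      (fun n x m y => by
        rw [apply_monomial_eq hgf hgs, hw]
        simp [lie_monomial, hΦ]) a b
  rw [← key, hg]; ring

end LoopForms

/-! ### Passage to the affine algebra and its derived algebra -/

open Loop UntwistedAffine

variable {𝔤 : Type*} [LieRing 𝔤] [LieAlgebra ℂ 𝔤]

lemma sub_loop (X Y : UntwistedAffine 𝔤) : (X - Y).loop = X.loop - Y.loop := rfl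

lemma sub_cCoeff (X Y : UntwistedAffine 𝔤) : (X - Y).cCoeff = X.cCoeff - Y.cCoeff := rfl

lemma sub_dCoeff (X Y : UntwistedAffine 𝔤) : (X - Y).dCoeff = X.dCoeff - Y.dCoeff := rfl

/-- The inclusion of the loop algebra in the untwisted affine Lie algebra. -/
noncomputable def loopInclusion : Loop 𝔤 →ₗ[ℂ] UntwistedAffine 𝔤 where
  toFun a := ⟨a, 0, 0⟩
  map_add' _ _ := by ext1 <;> simp
  map_smul' _ _ := by ext1 <;> simp

@[simp] lemma loopInclusion_loop (a : Loop 𝔤) : (loopInclusion a).loop = a := rfl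
@[simp] lemma loopInclusion_cCoeff (a : Loop 𝔤) : (loopInclusion a).cCoeff = 0 := rfl
@[simp] lemma loopInclusion_dCoeff (a : Loop 𝔤) : (loopInclusion a).dCoeff = 0 := rfl

/-- The functional on the untwisted affine Lie algebra that restricts to `Φ` on the loop algebra,
takes the value `μ` at `c` and vanishes at `d`. -/
noncomputable def extendFunctional (Φ : Loop 𝔤 →ₗ[ℂ] ℂ) (μ : ℂ) : UntwistedAffine 𝔤 →ₗ[ℂ] ℂ where
  toFun X := Φ X.loop + μ * X.cCoeff
  map_add' X Y := by simp only [add_loop, add_cCoeff, map_add]; ring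
  map_smul' r X := by
    simp only [smul_loop, smul_cCoeff, map_smul, smul_eq_mul, RingHom.id_apply]; ring

lemma extendFunctional_apply (Φ : Loop 𝔤 →ₗ[ℂ] ℂ) (μ : ℂ) (X : UntwistedAffine 𝔤) :
    extendFunctional Φ μ X = Φ X.loop + μ * X.cCoeff := rfl

lemma lie_eq_zero_of_loop_eq_zero {X : UntwistedAffine 𝔤} (h : X.loop = 0) (hd : X.dCoeff = 0)
    (Y : UntwistedAffine 𝔤) : ⁅X, Y⁆ = 0 := by
  ext1 <;> simp [h, hd]

lemma dCoeff_of_mem_derivedAlgebra {X : UntwistedAffine 𝔤} (hX : X ∈ derivedAlgebra 𝔤) :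
    X.dCoeff = 0 := by
  rw [← LieSubmodule.mem_toSubmodule, LieSubmodule.lieIdeal_oper_eq_linear_span'] at hX
  induction hX using Submodule.span_induction with
  | mem x hx => obtain ⟨y, -, z, -, rfl⟩ := hx; rfl
  | zero => rfl
  | add x y _ _ hx hy => rw [add_dCoeff, hx, hy, add_zero]
  | smul r x _ hx => rw [smul_dCoeff, hx, smul_zero]

variable [FiniteDimensional ℂ 𝔤] [LieAlgebra.IsKilling ℂ 𝔤]

lemma loopInclusion_mem_derivedAlgebra (a : Loop 𝔤) : loopInclusion a ∈ derivedAlgebra 𝔤 := by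
  induction a using loop_induction with
  | h0 => rw [map_zero]; exact zero_mem _
  | hadd a b ha hb => rw [map_add]; exact add_mem ha hb
  | hm n x =>
    have hx : x ∈ Submodule.span ℂ {e : 𝔤 | ∃ y : 𝔤, ⁅y, e⁆ = e} := by
      rw [span_lie_eq_self_eq_top]; trivial
    have hle : Submodule.span ℂ {e : 𝔤 | ∃ y : 𝔤, ⁅y, e⁆ = e} ≤
        (derivedAlgebra 𝔤).toSubmodule.comap (loopInclusion ∘ₗ monomialLinear n) := by
      refine Submodule.span_le.mpr ?_
      rintro e ⟨y, hy⟩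
      have h : loopInclusion (monomial n e) =
          ⁅loopInclusion (monomial 0 y), loopInclusion (monomial n e)⁆ := by
        ext1 <;> simp [lie_monomial, hy, loopCocycle_monomial]
      change loopInclusion (monomial n e) ∈ derivedAlgebra 𝔤
      rw [h]
      exact LieSubmodule.lie_mem_lie (LieSubmodule.mem_top _) (LieSubmodule.mem_top _)
    exact hle hx

/-- A form on the untwisted affine Lie algebra vanishing on commuting pairs factors through the
bracket. -/
theorem exists_untwistedAffine_functional
    {f : UntwistedAffine 𝔤 →ₗ[ℂ] UntwistedAffine 𝔤 →ₗ[ℂ] ℂ}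
    (hf : ∀ X Y : UntwistedAffine 𝔤, ⁅X, Y⁆ = 0 → f X Y = 0) :
    ∃ Ψ : UntwistedAffine 𝔤 →ₗ[ℂ] ℂ, ∀ X Y, f X Y = Ψ ⁅X, Y⁆ := by
  obtain ⟨Φ, μ, hΦ⟩ := exists_loop_form (f := f.compl₁₂ loopInclusion loopInclusion)
    fun a b h1 h2 => hf _ _ (by ext1 <;> simp [h1, h2])
  simp only [LinearMap.compl₁₂_apply] at hΦ
  have hd : ∀ b, f (d 𝔤) (loopInclusion b) = Φ (loopDegree 𝔤 b) := by
    refine loop_linear_ext (f := f (d 𝔤) ∘ₗ loopInclusion) (g := Φ ∘ₗ loopDegree 𝔤) fun n x => ?_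
    have hlin : f (d 𝔤) ∘ₗ loopInclusion ∘ₗ monomialLinear n =
        (n : ℂ) • (Φ ∘ₗ monomialLinear n) := by
      refine LinearMap.ext_on span_lie_eq_self_eq_top ?_
      rintro e ⟨y, hy⟩
      -- Both d and n y(0) send e(n) to n e(n), so their difference commutes with it.
      have h := hf (d 𝔤 - (n : ℂ) • loopInclusion (monomial 0 y)) (loopInclusion (monomial n e))
        (by
          ext1 <;> simp [sub_loop, sub_cCoeff, sub_dCoeff, d, lie_monomial, hy, loopDegree_monomial,
            loopCocycle_monomial])
      rw [map_sub, map_smul, LinearMap.sub_apply, LinearMap.smul_apply, hΦ, lie_monomial, hy,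
        zero_add, loopCocycle_monomial, Int.cast_zero, zero_mul, ite_self, mul_zero, add_zero,
        sub_eq_zero] at h
      exact h
    have h := LinearMap.congr_fun hlin x
    simpa [monomialLinear_apply, loopDegree_monomial] using h
  have hskew := form_skew hf
  have hdecomp : ∀ X : UntwistedAffine 𝔤,
      X = loopInclusion X.loop + X.dCoeff • d 𝔤 + X.cCoeff • c 𝔤 := fun X => by
    ext1 <;> simp [d, c]
  have hc : ∀ X, f (c 𝔤) X = 0 := fun X => hf _ _ (lie_c X)
  have hc' : ∀ X, f X (c 𝔤) = 0 := fun X => by rw [hskew, hc, neg_zero]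
  refine ⟨extendFunctional Φ μ, fun X Y => ?_⟩
  conv_lhs => rw [hdecomp X, hdecomp Y]
  simp only [map_add, map_sub, map_smul, LinearMap.add_apply, LinearMap.smul_apply, hc, hc',
    hskew (loopInclusion X.loop) (d 𝔤), hf (d 𝔤) (d 𝔤) (lie_self _), hΦ, hd,
    extendFunctional_apply, lie_loop, lie_cCoeff, smul_eq_mul]
  ring

/-- A form on the derived algebra vanishing on commuting pairs factors through the bracket. -/
theorem exists_derivedAlgebra_functional
    {f : derivedAlgebra 𝔤 →ₗ[ℂ] derivedAlgebra 𝔤 →ₗ[ℂ] ℂ}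
    (hf : ∀ X Y : derivedAlgebra 𝔤, ⁅X, Y⁆ = 0 → f X Y = 0) :
    ∃ Ψ : derivedAlgebra 𝔤 →ₗ[ℂ] ℂ, ∀ X Y, f X Y = Ψ ⁅X, Y⁆ := by
  let ι : Loop 𝔤 →ₗ[ℂ] derivedAlgebra 𝔤 :=
    { toFun := fun a => ⟨loopInclusion a, loopInclusion_mem_derivedAlgebra a⟩
      map_add' := fun a b => Subtype.ext (map_add loopInclusion a b)
      map_smul' := fun r a => Subtype.ext (map_smul loopInclusion r a) }
  have hι : ∀ a, (ι a : UntwistedAffine 𝔤) = loopInclusion a := fun _ => rfl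
  obtain ⟨Φ, μ, hΦ⟩ := exists_loop_form (f := f.compl₁₂ ι ι)
    fun a b h1 h2 => hf _ _ (Subtype.ext (by
      change ⁅loopInclusion a, loopInclusion b⁆ = 0
      ext1 <;> simp [h1, h2]))
  simp only [LinearMap.compl₁₂_apply] at hΦ
  have hskew := form_skew hf
  -- Elements of the derived algebra have no d-component, so removing the loop part leaves a
  -- multiple of the central element.
  have hcentral : ∀ X Y : derivedAlgebra 𝔤, f (X - ι (X : UntwistedAffine 𝔤).loop) Y = 0 := by
    intro X Y
    refine hf _ _ (Subtype.ext ?_)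
    refine lie_eq_zero_of_loop_eq_zero ?_ (dCoeff_of_mem_derivedAlgebra (Subtype.property _))
      (Y : UntwistedAffine 𝔤)
    rw [LieSubmodule.coe_sub, hι, sub_loop, loopInclusion_loop, sub_self]
  have hleft : ∀ X Y : derivedAlgebra 𝔤, f X Y = f (ι (X : UntwistedAffine 𝔤).loop) Y :=
    fun X Y => by
      have h := hcentral X Y
      rwa [map_sub, LinearMap.sub_apply, sub_eq_zero] at h
  refine ⟨extendFunctional Φ μ ∘ₗ (derivedAlgebra 𝔤).toSubmodule.subtype, fun X Y => ?_⟩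
  rw [hleft, hskew, hleft, ← hskew, hΦ]
  have hX := dCoeff_of_mem_derivedAlgebra X.2
  have hY := dCoeff_of_mem_derivedAlgebra Y.2
  change _ = extendFunctional Φ μ ⁅(X : UntwistedAffine 𝔤), (Y : UntwistedAffine 𝔤)⁆
  rw [extendFunctional_apply, lie_loop, lie_cCoeff, hX, hY]
  simp

lemma isZeroProductDetermined_of_forall_exists {F L : Type*} [Field F] [LieRing L] [LieAlgebra F L]
    (h : ∀ f : L →ₗ[F] L →ₗ[F] F, (∀ x y : L, ⁅x, y⁆ = 0 → f x y = 0) →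
      ∃ Ψ : L →ₗ[F] F, ∀ x y, f x y = Ψ ⁅x, y⁆) : IsZeroProductDetermined F L := by
  intro f hf
  obtain ⟨Ψ, hΨ⟩ := h f hf
  exact ⟨Ψ ∘ₗ (⁅(⊤ : LieIdeal F L), (⊤ : LieIdeal F L)⁆ : LieIdeal F L).toSubmodule.subtype, hΨ⟩

end ZeroProductDetermined

theorem theorem8p2 (𝔤 : Type*) [LieRing 𝔤] [LieAlgebra ℂ 𝔤] [FiniteDimensional ℂ 𝔤]
    [LieAlgebra.IsSimple ℂ 𝔤] :
    IsZeroProductDetermined ℂ (UntwistedAffine 𝔤) ∧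
      IsZeroProductDetermined ℂ (UntwistedAffine.derivedAlgebra 𝔤) :=
  ⟨ZeroProductDetermined.isZeroProductDetermined_of_forall_exists fun _ hf =>
      ZeroProductDetermined.exists_untwistedAffine_functional hf,
    ZeroProductDetermined.isZeroProductDetermined_of_forall_exists fun _ hf =>
      ZeroProductDetermined.exists_derivedAlgebra_functional hf⟩
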